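/- Let $n\ge 2$ be an integer and let $\theta=(\theta_1,\dots,\theta_n)\in\mathbb R^n$ be such that $1,\theta_1,\dots,\theta_n$ are linearly independent over $\mathbb Q$. Let $\ell\subset\mathbb R^{n+1}$ be the line spanned by $(1,\theta_1,\dots,\theta_n)$ and $\ell^\perp$ its orthogonal complement; for $x\in\mathbb R^{n+1}$ let $r(x)$ and $h(x)$ be the Euclidean distances from $x$ to $\ell$ and to $\ell^\perp$. For a subspace $\mathcal L$ of $\mathbb R^{n+1}$ let $\varphi(\mathcal L)\in[0,\infty]$ be the tangent of the angle between $\ell$ and $\mathcal L$ (equal to $\infty$ for a right angle), and, if $\mathcal L$ is defined over $\mathbb Q$, let $H(\mathcal L)$ be its height, i.e. the covolume of the lattice $\mathcal L\cap\mathbb Z^{n+1}$ in $\mathcal L$. Let $\omega=\omega(\theta)\in[-\infty,\infty]$ be the supremum of the real numbers $\gamma$ such that for some arbitrarily large $t$ the system $|x_0+\theta_1x_1+\dots+\theta_nx_n|\le t^{-\gamma}$, $0<\max_{1\le i\le n}|x_i|\le t$ has a solution $(x_0,\dots,x_n)\in\mathbb Z^{n+1}$. Then for every $\varepsilon>0$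 there is a constant $c>0$, depending only on $\theta$ (including $n$) and $\varepsilon$, with the following property. Let $\alpha,\beta,c_1,c_2$ be positive real numbers with $\beta\ge\alpha$, and let $(t_k)_{k\in\mathbb N}$ be a (not necessarily strictly) increasing sequence of positive real numbers with $$\lim_{k\to\infty}t_k=\infty,\qquad \limsup_{k\to\infty}\frac{\log t_{k+1}}{\log t_k}=1,$$ such that for every sufficiently large $k$ there is $x\in\mathbb Z^{n+1}$ with $r(x)\le t_k$ and $c_1t_k^{-\beta}\le h(x)\le c_2t_k^{-\alpha}$. Suppose that $$\frac{(\alpha-1)(1+\beta)}{\alpha(1+\beta-\alpha)}>n-1 .$$ Then $$\omega\le\frac{(n-1)\alpha(1+\beta-\alpha)}{(\alpha-1)(1+\beta)-(n-1)\alpha(1+\beta-\alpha)},$$ and every $n$-dimensional subspace $\mathcal L$ of $\mathbb R^{n+1}$ defined over $\mathbb Q$ satisfies $$\varphi(\mathcal L)\ge c\,H(\mathcal L)^{-\delta-\varepsilon},\qquad \delta=\frac{(\alpha-1)(1+\beta)}{(\alpha-1)(1+\beta)-(n-1)\alpha(1+\beta-\alpha)} .$$ -/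

import Mathlib

open Filter Topology

noncomputable section

namespace Nesterenko

/-- The ambient Euclidean space `ℝⁿ⁺¹`. -/
abbrev Space (n : ℕ) : Type := EuclideanSpace ℝ (Fin (n + 1))

/-- The point `(1, θ₁, …, θₙ)`. -/
def point {n : ℕ} (θ : Fin n → ℝ) : Space n :=
  WithLp.toLp 2 (Fin.cons 1 θ : Fin (n + 1) → ℝ)

/-- The line `ℓ` spanned by `(1, θ₁, …, θₙ)`. -/
def line {n : ℕ} (θ : Fin n → ℝ) : Submodule ℝ (Space n) :=
  Submodule.span ℝ {point θ}

/-- An integer vector as a point of the Euclidean space. -/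
def intPoint {n : ℕ} (x : Fin (n + 1) → ℤ) : Space n :=
  WithLp.toLp 2 (fun i => (x i : ℝ))

/-- `r(x)`: the Euclidean distance from `x` to the line `ℓ`. -/
def r {n : ℕ} (θ : Fin n → ℝ) (x : Space n) : ℝ :=
  Metric.infDist x (line θ : Set (Space n))

/-- `h(x)`: the Euclidean distance from `x` to the orthogonal complement of `ℓ`. -/
def h {n : ℕ} (θ : Fin n → ℝ) (x : Space n) : ℝ :=
  Metric.infDist x ((line θ)ᗮ : Set (Space n))

/-- The regular Diophantine exponent `ω(θ)`, possibly `+∞`: the supremum of the reals `γ` such that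
`|x₀ + θ₁x₁ + … + θₙxₙ| ≤ t ^ (-γ)`, `0 < max (|x₁|, …, |xₙ|) ≤ t` is solvable in integers for
some arbitrarily large `t`. The norm on `Fin n → ℝ` is the maximum norm. -/
def omega {n : ℕ} (θ : Fin n → ℝ) : EReal :=
  sSup ((fun γ : ℝ => (γ : EReal)) '' {γ : ℝ | ∃ᶠ t : ℝ in atTop, ∃ x : Fin (n + 1) → ℤ,
    |(x 0 : ℝ) + ∑ i : Fin n, θ i * (x i.succ : ℝ)| ≤ t ^ (-γ) ∧
    0 < ‖(fun i : Fin n => (x i.succ : ℝ))‖ ∧ ‖(fun i : Fin n => (x i.succ : ℝ))‖ ≤ t})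

/-- The subspace `L` is defined over `ℚ`: it is spanned by its rational points. -/
def IsRational {n : ℕ} (L : Submodule ℝ (Space n)) : Prop :=
  Submodule.span ℝ {x : Space n | x ∈ L ∧ ∀ i, ∃ q : ℚ, x i = (q : ℝ)} = L

/-- The lattice `ℤⁿ⁺¹` in the Euclidean space. -/
def intLattice (n : ℕ) : Submodule ℤ (Space n) :=
  Submodule.span ℤ (Set.range (EuclideanSpace.basisFun (Fin (n + 1)) ℝ))

/-- The lattice `L ∩ ℤⁿ⁺¹`, as a lattice in the Euclidean space `L`. -/
def latticeIn {n : ℕ} (L : Submodule ℝ (Space n)) : Submodule ℤ L :=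
  (intLattice n).comap (L.subtype.restrictScalars ℤ)

/-- The height `H(L)`: the covolume of `L ∩ ℤⁿ⁺¹` in `L`, for the Euclidean volume of `L`. -/
def height {n : ℕ} (L : Submodule ℝ (Space n)) : ℝ :=
  ZLattice.covolume (latticeIn L) (@MeasureTheory.volume L measureSpaceOfInnerProductSpace)

/-- The angle in `[0, π/2]` between the line `ℓ` and the subspace `L`, that is, between the point
`(1, θ₁, …, θₙ)` and its orthogonal projection to `L` (it is `π/2` if this projection is `0`). -/
def angle {n : ℕ} (θ : Fin n → ℝ) (L : Submodule ℝ (Space n)) : ℝ :=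
  InnerProductGeometry.angle (point θ) (L.starProjection (point θ))

open Classical in
/-- `φ(L)`: the tangent of the angle between `ℓ` and `L`, with the value `∞` at a right angle. -/
def phi {n : ℕ} (θ : Fin n → ℝ) (L : Submodule ℝ (Space n)) : ENNReal :=
  if angle θ L = Real.pi / 2 then ⊤ else ENNReal.ofReal (Real.tan (angle θ L))

/-- The hypothesis of the linear independence criterion, for the parameters `α, β, c₁, c₂` and the
sequence `t`. The upper limit is taken in the extended reals. -/
structure Hypothesis {n : ℕ} (θ : Fin n → ℝ) (α β c₁ c₂ : ℝ) (t : ℕ → ℝ) : Prop where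
  alpha_pos : 0 < α
  alpha_le_beta : α ≤ β
  c₁_pos : 0 < c₁
  c₂_pos : 0 < c₂
  t_pos : ∀ k, 0 < t k
  t_mono : Monotone t
  t_tendsto : Tendsto t atTop atTop
  t_limsup : limsup (fun k => ((Real.log (t (k + 1)) / Real.log (t k) : ℝ) : EReal)) atTop = 1
  exists_point : ∀ᶠ k in atTop, ∃ x : Fin (n + 1) → ℤ,
    r θ (intPoint x) ≤ t k ∧
    c₁ * t k ^ (-β) ≤ h θ (intPoint x) ∧ h θ (intPoint x) ≤ c₂ * t k ^ (-α)

end Nesterenko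

end

/-! The proof plays two estimates for simultaneous approximation to `θ` against each other. Write L
for the linear form and call pᵢ - θᵢp₀ the defects of p. The hypothesis, with its constants and the
gaps of the sequence absorbed into exponents a < α and b > β, gives at every large height T a form x
with T^(-b) ≤ |L(x)| ≤ T^(-a) (`Hypothesis.uniformlySmall`). Pairing x with an integer vector p
shows that p cannot have very small defects (`UniformlySmall.exists_le_defect`). Conversely, let w
be primitive with coefficients at most W and |L(w)| = l ≤ W^(-γ), and take x as above at height
about l^(-1/a). The minors of w and x without constant coefficients do not all vanish, and
Minkowski's theorem gives a nonzero p orthogonal to both with small defects (`exists_defect_le`). As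
l → 0 the two estimates are compatible only if γ satisfies a polynomial inequality
(`UniformlySmall.transference`); letting a → α, b → β bounds ω. For the angle, a rational hyperplane
has an integer normal q of length equal to its height (`IsRational.exists_normal`), and the tangent
is at least |L(q)| / (‖q‖ ‖(1, θ)‖). The bound on ω controls |L(q)| from below, and the extra factor
‖q‖ makes δ one more than the bound on ω. -/

/-! ### Linear form, defects and Minkowski's theorem -/

/-- The linear form `x₀ + θ₁x₁ + … + θₙxₙ`. -/
def linForm {n : ℕ} (θ : Fin n → ℝ) (x : Fin (n + 1) → ℤ) : ℝ :=
  (x 0 : ℝ) + ∑ i : Fin n, θ i * (x i.succ : ℝ)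

/-- The defect `pᵢ - θᵢp₀` of `p` as a simultaneous approximation to `θ`. -/
def defect {n : ℕ} (θ : Fin n → ℝ) (p : Fin (n + 1) → ℤ) (i : Fin n) : ℝ :=
  (p i.succ : ℝ) - θ i * (p 0 : ℝ)

/-- Minkowski's theorem on linear forms. -/
theorem exists_int_ne_zero_abs_mulVec_lt {ι : Type*} [Fintype ι] [DecidableEq ι]
    (A : Matrix ι ι ℝ) (c : ι → ℝ) (hc : ∀ i, 0 < c i) (hA : A.det ≠ 0)
    (hlt : |A.det| < ∏ i, c i) :
    ∃ p : ι → ℤ, p ≠ 0 ∧ ∀ i, |(A.mulVec (fun j => (p j : ℝ))) i| < c i := by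
  classical
  set b := Pi.basisFun ℝ ι with hb
  have fund := ZSpan.isAddFundamentalDomain b (MeasureTheory.volume : MeasureTheory.Measure (ι → ℝ))
  -- The preimage of the open box is convex and symmetric, of volume 2 ^ card ι · ∏ cᵢ / |det A|,
  -- which exceeds 2 ^ card ι.
  set s : Set (ι → ℝ) := (Matrix.toLin' A) ⁻¹' (Set.pi Set.univ fun i => Set.Ioo (-c i) (c i))
    with hs
  have hmem : ∀ v : ι → ℝ, v ∈ s ↔ ∀ i, |(A.mulVec v) i| < c i := by
    intro v
    simp [hs, Set.mem_pi, abs_lt]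
  have hdet : LinearMap.det (Matrix.toLin' A) ≠ 0 := by simpa using hA
  have hvolF : MeasureTheory.volume (ZSpan.fundamentalDomain b) = 1 := by
    rw [ZSpan.volume_fundamentalDomain]
    have : Matrix.of b = (1 : Matrix ι ι ℝ) := by
      ext i j
      simp [hb, Matrix.one_apply, Pi.single_apply, eq_comm]
    rw [this]; simp
  have hvol : MeasureTheory.volume s
      = ENNReal.ofReal (|A.det|⁻¹ * (2 ^ Fintype.card ι * ∏ i, c i)) := by
    rw [hs, MeasureTheory.Measure.addHaar_preimage_linearMap _ hdet, Real.volume_pi_Ioo,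
      ← ENNReal.ofReal_prod_of_nonneg (fun i _ => by linarith [hc i]),
      ← ENNReal.ofReal_mul (abs_nonneg _), LinearMap.det_toLin', abs_inv]
    congr 2
    rw [← Finset.card_univ, ← Finset.prod_const, ← Finset.prod_mul_distrib]
    exact Finset.prod_congr rfl fun i _ => by ring
  have key : MeasureTheory.volume (ZSpan.fundamentalDomain b) * 2 ^ Module.finrank ℝ (ι → ℝ)
      < MeasureTheory.volume s := by
    rw [hvolF, hvol, one_mul, Module.finrank_fintype_fun_eq_card,
      show (2 : ENNReal) = ENNReal.ofReal 2 by simp, ← ENNReal.ofReal_pow (by norm_num)]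
    have h1 : 0 < |A.det| := abs_pos.2 hA
    refine (ENNReal.ofReal_lt_ofReal_iff_of_nonneg (by positivity)).2 ?_
    rw [inv_mul_eq_div, lt_div_iff₀ h1]
    gcongr
  have hconv : Convex ℝ s :=
    (convex_pi fun i _ => convex_Ioo _ _).linear_preimage _
  have hsymm : ∀ v ∈ s, -v ∈ s := by
    intro v hv
    rw [hmem] at hv ⊢
    intro i
    simpa [Matrix.mulVec_neg] using hv i
  have : Countable (Submodule.span ℤ (Set.range b)).toAddSubgroup :=
    inferInstanceAs (Countable (Submodule.span ℤ (Set.range b)))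
  obtain ⟨⟨v, hvL⟩, hv0, hvs⟩ :=
    MeasureTheory.exists_ne_zero_mem_lattice_of_measure_mul_two_pow_lt_measure
    (L := (Submodule.span ℤ (Set.range b)).toAddSubgroup) fund hsymm hconv key
  have hint := (b.mem_span_iff_repr_mem ℤ v).1 hvL
  choose p hp using hint
  have hpv : (fun j => (p j : ℝ)) = v := by
    ext j
    simpa [hb] using hp j
  refine ⟨p, ?_, ?_⟩
  · rintro rfl
    apply hv0
    ext j
    simp [← hpv]
  · rw [hpv]
    exact (hmem v).1 hvs

/-- Integer scalar product in terms of the linear form and the defects. -/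
theorem sum_mul_eq_linForm {n : ℕ} (θ : Fin n → ℝ) (x p : Fin (n + 1) → ℤ) :
    ((∑ i, x i * p i : ℤ) : ℝ) =
      (p 0 : ℝ) * linForm θ x + ∑ i, (x i.succ : ℝ) * defect θ p i := by
  simp only [linForm, defect, Fin.sum_univ_succ, mul_add, Finset.mul_sum, mul_sub,
    Finset.sum_sub_distrib]
  push_cast
  have : ∑ i : Fin n, (p 0 : ℝ) * (θ i * (x i.succ : ℝ))
      = ∑ i : Fin n, (x i.succ : ℝ) * (θ i * (p 0 : ℝ)) :=
    Finset.sum_congr rfl fun i _ => by ring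
  rw [this]
  ring

/-! ### Integer vectors orthogonal to two forms -/

/-- The determinant of the identity with the rows `i` and `j` replaced by `a` and `b`. -/
theorem det_one_updateRow_updateRow {ι : Type*} [Fintype ι] [DecidableEq ι] {i j : ι}
    (hij : i ≠ j) (a b : ι → ℝ) :
    (((1 : Matrix ι ι ℝ).updateRow i a).updateRow j b).det = a i * b j - a j * b i := by
  -- The matrix is a perturbation of the identity of rank at most two, so det (1 + UV) = det (1 +
  -- VU) reduces it to a 2 × 2 determinant.
  set U : Matrix ι (Fin 2) ℝ := Matrix.of fun m => ![(Pi.single i 1 : ι → ℝ) m, (Pi.single j 1 : ι → ℝ) m]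
  set V : Matrix (Fin 2) ι ℝ := Matrix.of ![a - Pi.single i 1, b - Pi.single j 1]
  have : ((1 : Matrix ι ι ℝ).updateRow i a).updateRow j b = 1 + U * V := by
    ext m l
    by_cases hj : m = j
    · subst hj
      simp [U, V, Matrix.mul_apply, Fin.sum_univ_two, Matrix.one_apply, Pi.single_apply,
        eq_comm]
      rw [if_neg hij]
      ring
    · by_cases hi : m = i
      · subst hi
        simp [U, V, Matrix.mul_apply, Fin.sum_univ_two, Matrix.one_apply, Pi.single_apply, hij,
          Matrix.updateRow_apply, eq_comm]
        rw [if_neg (Ne.symm hj)]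
        ring
      · simp [U, V, Matrix.mul_apply, Fin.sum_univ_two, Pi.single_apply, hi, hj,
          Matrix.updateRow_apply]
  have hVU : V * U = !![a i - 1, a j; b i, b j - 1] := by
    ext s t
    rw [Matrix.mul_apply]
    fin_cases s <;> fin_cases t <;>
      simp [U, V, Pi.single_apply, hij, hij.symm]
  rw [this, Matrix.det_one_add_mul_comm, hVU, Matrix.det_fin_two]
  simp

/-- The unimodular matrix of `p ↦ (p₀, p₁ - θ₁p₀, …, pₙ - θₙp₀)`. -/
def defectMatrix {n : ℕ} (θ : Fin n → ℝ) : Matrix (Fin (n + 1)) (Fin (n + 1)) ℝ :=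
  1 + Matrix.replicateCol (Fin 1) (Fin.cons 0 (fun i => -θ i)) *
    Matrix.replicateRow (Fin 1) (Pi.single 0 1 : Fin (n + 1) → ℝ)

theorem det_defectMatrix {n : ℕ} (θ : Fin n → ℝ) : (defectMatrix θ).det = 1 := by
  rw [defectMatrix, Matrix.det_one_add_mul_comm]
  simp [Matrix.mul_apply, Pi.single_apply]

theorem defectMatrix_mulVec {n : ℕ} (θ : Fin n → ℝ) (p : Fin (n + 1) → ℤ) :
    (defectMatrix θ).mulVec (fun j => (p j : ℝ)) = Fin.cons (p 0 : ℝ) (defect θ p) := by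
  ext m
  rw [defectMatrix, Matrix.add_mulVec, ← Matrix.mulVec_mulVec]
  refine Fin.cases ?_ (fun k => ?_) m <;>
    simp [defect, Matrix.mulVec, dotProduct, Matrix.mul_apply, Pi.single_apply, sub_eq_add_neg]

/-- Eliminating the j-th defect from the two orthogonality relations leaves the i-th one with
coefficient ±Δ. As Δ is the largest minor, the other coefficients are at most Δ, so division by Δ
costs nothing. -/
theorem abs_defect_le_of_orthogonal {n : ℕ} (θ : Fin n → ℝ) (w x p : Fin (n + 1) → ℤ)
    {i j : Fin n} {Δ D P R : ℝ} (hΔ : 0 < Δ)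
    (hij : |(w i.succ : ℝ) * x j.succ - w j.succ * x i.succ| = Δ)
    (hmax : ∀ k l : Fin n, |(w k.succ : ℝ) * x l.succ - w l.succ * x k.succ| ≤ Δ)
    (hD : ∀ k : Fin n, |linForm θ w * x k.succ - linForm θ x * w k.succ| ≤ D)
    (hw : ∑ m, w m * p m = 0) (hx : ∑ m, x m * p m = 0) (hR : 0 ≤ R) (hp0 : |(p 0 : ℝ)| ≤ P)
    (hp : ∀ m, m ≠ i → m ≠ j → |defect θ p m| ≤ R) :
    |defect θ p i| ≤ n * R + P * D / Δ := by
  have hw' := sum_mul_eq_linForm θ w p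
  have hx' := sum_mul_eq_linForm θ x p
  rw [hw] at hw'
  rw [hx] at hx'
  have hsum : ∑ m, ((w m.succ : ℝ) * x j.succ - w j.succ * x m.succ) * defect θ p m
      = -((p 0 : ℝ) * (linForm θ w * x j.succ - linForm θ x * w j.succ)) := by
    have : ∑ m, ((w m.succ : ℝ) * x j.succ - w j.succ * x m.succ) * defect θ p m
        = x j.succ * (∑ m, (w m.succ : ℝ) * defect θ p m)
          - w j.succ * (∑ m, (x m.succ : ℝ) * defect θ p m) := by
      rw [Finset.mul_sum, Finset.mul_sum, ← Finset.sum_sub_distrib]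
      exact Finset.sum_congr rfl fun m _ => by ring
    rw [this]
    push_cast at hw' hx'
    linear_combination (-(x j.succ : ℝ)) * hw' + (w j.succ : ℝ) * hx'
  rw [← Finset.add_sum_erase _ _ (Finset.mem_univ i)] at hsum
  have h1 : |∑ m ∈ Finset.univ.erase i,
      ((w m.succ : ℝ) * x j.succ - w j.succ * x m.succ) * defect θ p m| ≤ n * (Δ * R) := by
    refine (Finset.abs_sum_le_sum_abs _ _).trans ?_
    refine (Finset.sum_le_card_nsmul _ _ (Δ * R) ?_).trans ?_
    · intro m hm
      by_cases hmj : m = j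
      · subst hmj
        rw [sub_self, zero_mul, abs_zero]
        positivity
      · rw [abs_mul]
        exact mul_le_mul (hmax m j) (hp m (Finset.ne_of_mem_erase hm) hmj) (abs_nonneg _) hΔ.le
    · rw [nsmul_eq_mul]
      have : ((Finset.univ.erase i).card : ℝ) ≤ n := by
        exact_mod_cast (Finset.card_le_univ _).trans (by simp)
      gcongr
  have h2 : |(p 0 : ℝ) * (linForm θ w * x j.succ - linForm θ x * w j.succ)| ≤ P * D := by
    rw [abs_mul]
    exact mul_le_mul hp0 (hD j) (abs_nonneg _) ((abs_nonneg _).trans hp0)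
  have h3 : Δ * |defect θ p i| ≤ n * (Δ * R) + P * D := by
    rw [← hij, ← abs_mul, hij]
    rw [abs_le] at h1 h2 ⊢
    constructor <;> linarith [h1.1, h1.2, h2.1, h2.2]
  have : Δ * (n * R + P * D / Δ) = n * (Δ * R) + P * D := by field_simp
  rw [← this] at h3
  exact le_of_mul_le_mul_left h3 hΔ

/-- A good simultaneous approximation from two small values of the linear form. -/
theorem exists_defect_le {n : ℕ} (θ : Fin n → ℝ) (w x : Fin (n + 1) → ℤ)
    {i j : Fin n} {Δ D R : ℝ} (hΔ : 0 < Δ) (hR : 0 < R)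
    (hij : |(w i.succ : ℝ) * x j.succ - w j.succ * x i.succ| = Δ)
    (hmax : ∀ k l : Fin n, |(w k.succ : ℝ) * x l.succ - w l.succ * x k.succ| ≤ Δ)
    (hD : ∀ k : Fin n, |linForm θ w * x k.succ - linForm θ x * w k.succ| ≤ D)
    (hRD : R ^ (n - 1) = D) :
    ∃ p : Fin (n + 1) → ℤ, p ≠ 0 ∧ |(p 0 : ℝ)| ≤ 2 * Δ / R ^ (n - 2) ∧
      ∀ k, |defect θ p k| ≤ (n + 2) * R := by
  have hne : i ≠ j := by
    rintro rfl
    rw [sub_self, abs_zero] at hij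
    exact hΔ.ne hij
  have hn : 2 ≤ n := by
    have := i.2; have := j.2
    have : (i : ℕ) ≠ j := fun h => hne (Fin.ext h)
    omega
  set a : Fin (n + 1) → ℝ := Fin.cons (linForm θ w) fun m => (w m.succ : ℝ) with ha
  set b : Fin (n + 1) → ℝ := Fin.cons (linForm θ x) fun m => (x m.succ : ℝ) with hb
  -- In the coordinates (p₀, defects), rows i and j compute the integers w·p and x·p, and box side 1
  -- forces them to vanish. The side for p₀ makes the product of the sides 2Δ, against a determinant
  -- of absolute value Δ.
  set T := ((1 : Matrix (Fin (n + 1)) (Fin (n + 1)) ℝ).updateRow i.succ a).updateRow j.succ b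
    with hT
  set c : Fin (n + 1) → ℝ := Fin.cons (2 * Δ / R ^ (n - 2))
    fun m => if m = i ∨ m = j then 1 else R with hc
  have hdet : (T * defectMatrix θ).det = (w i.succ : ℝ) * x j.succ - w j.succ * x i.succ := by
    rw [Matrix.det_mul, det_defectMatrix, mul_one, hT,
      det_one_updateRow_updateRow ((Fin.succ_injective n).ne hne)]
    simp [ha, hb]
  have hprod : ∏ m, c m = 2 * Δ := by
    rw [Fin.prod_univ_succ]
    simp only [hc, Fin.cons_zero, Fin.cons_succ]
    rw [Finset.prod_ite]
    have hcard : (Finset.univ.filter fun m : Fin n => ¬ (m = i ∨ m = j)).card = n - 2 := by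
      have : (Finset.univ.filter fun m : Fin n => ¬ (m = i ∨ m = j)) = ({i, j} : Finset (Fin n))ᶜ := by
        ext m; simp
      rw [this, Finset.card_compl, Finset.card_pair hne, Fintype.card_fin]
    rw [Finset.prod_const_one, Finset.prod_const, hcard, one_mul]
    field_simp
  obtain ⟨p, hp0, hp⟩ := exists_int_ne_zero_abs_mulVec_lt (T * defectMatrix θ) c
    (by
      intro m
      refine Fin.cases ?_ (fun k => ?_) m
      · simp only [hc, Fin.cons_zero]; positivity
      · simp only [hc, Fin.cons_succ]; split_ifs <;> positivity)
    (by rw [hdet]; intro h; rw [h, abs_zero] at hij; exact hΔ.ne hij)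
    (by rw [hdet, hij, hprod]; linarith)
  simp_rw [← Matrix.mulVec_mulVec, defectMatrix_mulVec] at hp
  have hrow : ∀ z : Fin (n + 1) → ℤ, (Fin.cons (linForm θ z) fun m => (z m.succ : ℝ) :
      Fin (n + 1) → ℝ) ⬝ᵥ (Fin.cons (p 0 : ℝ) (defect θ p)) = ((∑ m, z m * p m : ℤ) : ℝ) := by
    intro z
    rw [sum_mul_eq_linForm θ, dotProduct, Fin.sum_univ_succ]
    simp [mul_comm]
  have hzero : ∀ z : ℤ, |(z : ℝ)| < 1 → z = 0 := by
    intro z hz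
    have : |z| < 1 := by exact_mod_cast hz
    exact Int.abs_lt_one_iff.1 this
  have hxp : ∑ m, x m * p m = 0 := by
    apply hzero
    have := hp j.succ
    rw [← hrow x]
    simpa [hT, hc, Matrix.mulVec, hb] using this
  have hwp : ∑ m, w m * p m = 0 := by
    apply hzero
    have := hp i.succ
    rw [← hrow w]
    simpa [hT, hc, Matrix.mulVec, Matrix.updateRow_apply, ha, hne] using this
  have hp00 : |(p 0 : ℝ)| ≤ 2 * Δ / R ^ (n - 2) := by
    have := hp 0
    have h0i : (0 : Fin (n + 1)) ≠ i.succ := (Fin.succ_ne_zero i).symm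
    have h0j : (0 : Fin (n + 1)) ≠ j.succ := (Fin.succ_ne_zero j).symm
    have h1 : (T.mulVec (Fin.cons (p 0 : ℝ) (defect θ p))) 0 = p 0 := by
      rw [Matrix.mulVec, hT, Matrix.updateRow_ne h0j, Matrix.updateRow_ne h0i]
      change ((1 : Matrix _ _ ℝ).mulVec _) 0 = _
      simp
    rw [h1] at this
    exact this.le
  have hother : ∀ m, m ≠ i → m ≠ j → |defect θ p m| ≤ R := by
    intro m hmi hmj
    have := hp m.succ
    have h1 : (T.mulVec (Fin.cons (p 0 : ℝ) (defect θ p))) m.succ = defect θ p m := by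
      rw [Matrix.mulVec, hT, Matrix.updateRow_ne ((Fin.succ_injective n).ne hmj),
        Matrix.updateRow_ne ((Fin.succ_injective n).ne hmi)]
      change ((1 : Matrix _ _ ℝ).mulVec _) _ = _
      simp
    rw [h1] at this
    simpa [hc, hmi, hmj] using this.le
  have hfin : 2 * Δ / R ^ (n - 2) * D / Δ = 2 * R := by
    rw [← hRD, show n - 1 = (n - 2) + 1 by omega, pow_succ]
    field_simp
  refine ⟨p, hp0, hp00, fun k => ?_⟩
  by_cases hki : k = i
  · subst hki
    have := abs_defect_le_of_orthogonal θ w x p hΔ hij hmax hD hwp hxp hR.le hp00 hother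
    rw [hfin] at this
    linarith
  · by_cases hkj : k = j
    · subst hkj
      have := abs_defect_le_of_orthogonal θ w x p (i := k) (j := i) hΔ
        (by rw [abs_sub_comm]; exact hij) hmax hD hwp hxp hR.le hp00 (fun m h1 h2 => hother m h2 h1)
      rw [hfin] at this
      linarith
    · have := hother k hki hkj
      nlinarith [(Nat.cast_nonneg n : (0 : ℝ) ≤ n)]

/-! ### Lower bound for the defects -/

/-- Every large `T` bounds the coefficients of an integer linear form whose value at `θ` has absolute
value between `T ^ (-b)` and `T ^ (-a)`. -/
def UniformlySmall {n : ℕ} (θ : Fin n → ℝ) (a b : ℝ) : Prop :=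
  ∃ T₀ : ℝ, ∀ T : ℝ, T₀ ≤ T → ∃ x : Fin (n + 1) → ℤ, (∀ i : Fin n, |(x i.succ : ℝ)| ≤ T) ∧
    T ^ (-b) ≤ |linForm θ x| ∧ |linForm θ x| ≤ T ^ (-a)

theorem one_le_abs_intCast {z : ℤ} (hz : z ≠ 0) : (1 : ℝ) ≤ |(z : ℝ)| := by
  exact_mod_cast Int.one_le_abs hz

/-- Uniformly small linear forms prevent `θ` from having very good simultaneous approximations. -/
theorem UniformlySmall.exists_le_defect {n : ℕ} (hn : 0 < n) {θ : Fin n → ℝ} {a b : ℝ}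
    (ha : 0 < a) (hab : a ≤ b) (hU : UniformlySmall θ a b) :
    ∃ c : ℝ, 0 < c ∧ ∀ p : Fin (n + 1) → ℤ, p ≠ 0 → ∀ Y : ℝ, (∀ i, |defect θ p i| ≤ Y) →
      c * (max 1 |(p 0 : ℝ)|) ^ (-((1 + b - a) / a)) ≤ Y := by
  obtain ⟨T₀, hT₀⟩ := hU
  have hn' : (1 : ℝ) ≤ n := by exact_mod_cast hn
  -- The factor 2 ^ (1 / a) gives K ^ (-a) ≤ 1 / 2; with T = K Q ^ (1 / a) this yields |p₀ L(x)| ≤ 1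
  -- / 2.
  set K : ℝ := max T₀ 1 * 2 ^ (1 / a) with hK
  have h2 : (1 : ℝ) ≤ 2 ^ (1 / a) := Real.one_le_rpow (by norm_num) (by positivity)
  have hK1 : 1 ≤ K := one_le_mul_of_one_le_of_one_le (le_max_right _ _) h2
  have hK0 : 0 < K := by linarith
  have hKT : T₀ ≤ K := (le_max_left T₀ 1).trans
    (le_mul_of_one_le_right (by linarith [le_max_right T₀ 1]) h2)
  have hKa : K ^ (-a) ≤ 1 / 2 := by
    have : (2 : ℝ) ^ (1 / a) ≤ K := le_mul_of_one_le_left (by linarith) (le_max_right _ _)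
    calc K ^ (-a) ≤ ((2 : ℝ) ^ (1 / a)) ^ (-a) :=
          Real.rpow_le_rpow_of_nonpos (by linarith) this (by linarith)
      _ = 1 / 2 := by
          rw [← Real.rpow_mul (by norm_num), show 1 / a * -a = -1 by field_simp, Real.rpow_neg_one]
          norm_num
  have hKb1 : K ^ (-b - 1) ≤ 1 := Real.rpow_le_one_of_one_le_of_nonpos hK1 (by linarith)
  have hKbK : K ^ (-b - 1) ≤ K ^ (-1 : ℝ) := Real.rpow_le_rpow_of_exponent_le hK1 (by linarith)
  refine ⟨K ^ (-b - 1) / (2 * n), by positivity, fun p hp Y hY => ?_⟩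
  set Q : ℝ := max 1 |(p 0 : ℝ)| with hQ
  have hQ1 : 1 ≤ Q := le_max_left _ _
  have hQ0 : 0 < Q := by linarith
  have hY0 : 0 ≤ Y := (abs_nonneg _).trans (hY ⟨0, hn⟩)
  set T : ℝ := K * Q ^ (1 / a) with hT
  have hQa : (1 : ℝ) ≤ Q ^ (1 / a) := Real.one_le_rpow hQ1 (by positivity)
  have hT1 : T₀ ≤ T := hKT.trans (le_mul_of_one_le_right hK0.le hQa)
  have hTpos : 0 < T := by positivity
  have hTpow : ∀ s : ℝ, T ^ s = K ^ s * Q ^ (s / a) := by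
    intro s
    rw [hT, Real.mul_rpow hK0.le (by positivity), ← Real.rpow_mul hQ0.le]
    congr 2
    ring
  obtain ⟨x, hx, hxl, hxu⟩ := hT₀ T hT1
  have hsum := sum_mul_eq_linForm θ x p
  have hdef : |∑ i, (x i.succ : ℝ) * defect θ p i| ≤ n * (T * Y) := by
    refine (Finset.abs_sum_le_sum_abs _ _).trans ?_
    refine (Finset.sum_le_card_nsmul _ _ (T * Y) fun i _ => ?_).trans (by simp)
    rw [abs_mul]
    exact mul_le_mul (hx i) (hY i) (abs_nonneg _) hTpos.le
  have he0 : Q ^ (-((1 + b - a) / a)) ≤ 1 :=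
    Real.rpow_le_one_of_one_le_of_nonpos hQ1 (by
      have : 0 ≤ (1 + b - a) / a := div_nonneg (by linarith) ha.le
      linarith)
  -- If x·p = 0, the defect sum equals -p₀ L(x), and the lower bound on |L(x)| applies unless p₀ =
  -- 0, when the defects are integers. If x·p ≠ 0, the defect sum is at least 1 / 2, which gives the
  -- stronger order Q ^ (-1 / a).
  by_cases hN : ∑ i, x i * p i = 0
  · by_cases hp0 : p 0 = 0
    · obtain ⟨i, hi⟩ : ∃ i : Fin n, p i.succ ≠ 0 := by
        by_contra! hcon
        exact hp (funext fun m => Fin.cases hp0 hcon m)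
      have h1 : 1 ≤ Y := by
        refine le_trans ?_ (hY i)
        simpa [defect, hp0] using one_le_abs_intCast hi
      refine le_trans ?_ h1
      refine mul_le_one₀ ?_ (by positivity) he0
      rw [div_le_one (by positivity)]
      linarith
    · have hQp : Q = |(p 0 : ℝ)| := max_eq_right (one_le_abs_intCast hp0)
      rw [hN, Int.cast_zero] at hsum
      have h1 : Q * T ^ (-b) ≤ n * (T * Y) := by
        calc Q * T ^ (-b) ≤ |(p 0 : ℝ)| * |linForm θ x| := by rw [hQp]; gcongr
          _ = |∑ i, (x i.succ : ℝ) * defect θ p i| := by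
            rw [← abs_mul, eq_neg_of_add_eq_zero_left hsum.symm, abs_neg]
          _ ≤ _ := hdef
      have h2 : Q * T ^ (-b - 1) ≤ n * Y := by
        rw [Real.rpow_sub_one hTpos.ne', ← mul_div_assoc, div_le_iff₀ hTpos]
        linarith
      have h3 : Q * T ^ (-b - 1) = K ^ (-b - 1) * Q ^ (-((1 + b - a) / a)) := by
        rw [hTpow, mul_left_comm]
        congr 1
        nth_rewrite 1 [← Real.rpow_one Q]
        rw [← Real.rpow_add hQ0]
        congr 1
        field_simp
        ring
      rw [h3] at h2
      have h4 : 0 ≤ K ^ (-b - 1) * Q ^ (-((1 + b - a) / a)) := by positivity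
      rw [div_mul_eq_mul_div, div_le_iff₀ (by positivity)]
      linarith
  · have h1 := one_le_abs_intCast hN
    rw [hsum] at h1
    have h2 : |(p 0 : ℝ) * linForm θ x| ≤ 1 / 2 := by
      rw [abs_mul]
      calc |(p 0 : ℝ)| * |linForm θ x| ≤ Q * T ^ (-a) := by
            gcongr
            exact le_max_right _ _
        _ = K ^ (-a) := by
            rw [hTpow, show -a / a = -1 by field_simp, Real.rpow_neg_one]
            field_simp
        _ ≤ 1 / 2 := hKa
    have h3 : 1 / 2 ≤ n * (T * Y) := by linarith [(abs_add_le _ _).trans' h1]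
    have h4 : T ^ (-1 : ℝ) ≤ 2 * n * Y := by
      rw [Real.rpow_neg_one, inv_le_iff_one_le_mul₀ hTpos]
      linarith
    have h5 : K ^ (-b - 1) * Q ^ (-((1 + b - a) / a)) ≤ T ^ (-1 : ℝ) := by
      rw [hTpow]
      refine mul_le_mul hKbK (Real.rpow_le_rpow_of_exponent_le hQ1 ?_) (by positivity)
        (by positivity)
      rw [← neg_div]
      gcongr
      linarith
    rw [div_mul_eq_mul_div, div_le_iff₀ (by positivity)]
    linarith

/-! ### Transference between the two estimates -/

/-- A small primitive integer form and an integer form of smaller nonzero value at `θ` have a nonzero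
minor avoiding the constant coefficients. -/
theorem exists_minor_ne_zero {n : ℕ} {θ : Fin n → ℝ} {w x : Fin (n + 1) → ℤ}
    (hprim : Finset.univ.gcd w = 1) (hw1 : |linForm θ w| < 1) (hw0 : linForm θ w ≠ 0)
    (hx0 : linForm θ x ≠ 0) (hlt : |linForm θ x| < |linForm θ w|)
    (hD : ∀ k : Fin n, |linForm θ w * x k.succ - linForm θ x * w k.succ| < 1) :
    ∃ i j : Fin n, (w i.succ : ℝ) * x j.succ - w j.succ * x i.succ ≠ 0 := by
  -- If all these minors vanish, L(w)xⱼ - L(x)wⱼ is an integer of absolute value below 1, hence 0.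
  -- Then x is proportional to w, and by primitivity an integer multiple of it, against |L(x)| <
  -- |L(w)|.
  by_contra! hcon
  obtain ⟨j, hj⟩ : ∃ j : Fin n, w j.succ ≠ 0 := by
    by_contra! h
    have h1 : linForm θ w = w 0 := by simp [linForm, h]
    rw [h1] at hw1 hw0
    have : w 0 ≠ 0 := by exact_mod_cast hw0
    linarith [one_le_abs_intCast this]
  have hsucc : ∀ i : Fin n, w j.succ * x i.succ = x j.succ * w i.succ := by
    intro i
    have := hcon i j
    have h : (w j.succ : ℝ) * x i.succ = x j.succ * w i.succ := by linarith
    exact_mod_cast h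
  have hz : linForm θ w * x j.succ - linForm θ x * w j.succ
      = ((w 0 * x j.succ - x 0 * w j.succ : ℤ) : ℝ) := by
    have : (∑ i, θ i * (w i.succ : ℝ)) * x j.succ = (∑ i, θ i * (x i.succ : ℝ)) * w j.succ := by
      rw [Finset.sum_mul, Finset.sum_mul]
      refine Finset.sum_congr rfl fun i _ => ?_
      have h : (w j.succ : ℝ) * x i.succ = x j.succ * w i.succ := by exact_mod_cast hsucc i
      linear_combination (-θ i) * h
    simp only [linForm]
    push_cast
    linear_combination this
  have h0 : w 0 * x j.succ - x 0 * w j.succ = 0 := by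
    by_contra h
    have := one_le_abs_intCast h
    rw [← hz] at this
    linarith [hD j]
  have hall : ∀ m, w j.succ * x m = x j.succ * w m := by
    intro m
    refine Fin.cases ?_ hsucc m
    linarith
  have hdvd : w j.succ ∣ x j.succ := by
    have h1 : w j.succ ∣ Finset.univ.gcd fun m => x j.succ * w m :=
      Finset.dvd_gcd fun m _ => ⟨x m, (hall m).symm⟩
    rw [Finset.gcd_mul_left, hprim, mul_one] at h1
    exact (dvd_normalize_iff).1 h1
  obtain ⟨q, hq⟩ := hdvd
  have hx : ∀ m, x m = q * w m := by
    intro m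
    have := hall m
    rw [hq, mul_assoc] at this
    exact mul_left_cancel₀ hj this
  have hlin : linForm θ x = q * linForm θ w := by
    simp only [linForm, hx, mul_add, Finset.mul_sum]
    push_cast
    congr 1
    exact Finset.sum_congr rfl fun i _ => by ring
  have hq0 : q ≠ 0 := by
    rintro rfl
    simp [hlin] at hx0
  rw [hlin, abs_mul] at hlt
  have := one_le_abs_intCast hq0
  nlinarith [abs_nonneg (linForm θ w)]

/-- The basic inequality for one primitive linear form. -/
theorem UniformlySmall.eventually_le_rpow {n : ℕ} (hn : 2 ≤ n) {θ : Fin n → ℝ} {a b γ : ℝ}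
    (ha : 1 < a) (hab : a ≤ b) (hγ : a ≤ γ) (hU : UniformlySmall θ a b) :
    ∃ c : ℝ, 0 < c ∧ ∀ᶠ l : ℝ in 𝓝[>] 0, ∀ w : Fin (n + 1) → ℤ,
      Finset.univ.gcd w = 1 → |linForm θ w| = l → (∀ i : Fin n, |(w i.succ : ℝ)| ≤ l ^ (-(1 / γ))) →
      c ≤ l ^ ((1 - 1 / a) * (1 - (n - 2) * ((1 + b - a) / a)) / (n - 1)
        - (1 / γ + 1 / a) * ((1 + b - a) / a)) := by
  obtain ⟨c₀, hc₀, hlow⟩ := hU.exists_le_defect (by omega) (by linarith) hab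
  obtain ⟨T₀, hT₀⟩ := hU
  set e : ℝ := (1 + b - a) / a with he
  have ha0 : 0 < a := by linarith
  have he0 : 0 < e := div_pos (by linarith) ha0
  have hγ0 : 0 < γ := by linarith
  have hn' : (2 : ℝ) ≤ n := by exact_mod_cast hn
  set s : ℝ := 1 / γ + 1 / a with hs
  set k : ℝ := 1 - 1 / a with hk
  have hk0 : 0 < k := by
    have : 1 / a < 1 := by rw [div_lt_one ha0]; exact ha
    linarith
  set C : ℝ := (n + 2) * (4 ^ ((1 - (n - 2) * e) / (n - 1)) * 8 ^ e) with hC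
  have hC0 : 0 < C := by positivity
  refine ⟨c₀ / C, by positivity, ?_⟩
  have hT : Tendsto (fun l : ℝ => l ^ (-(1 / a))) (𝓝[>] 0) atTop := by
    have h1 : Tendsto (fun l : ℝ => (l⁻¹) ^ (1 / a)) (𝓝[>] 0) atTop :=
      (tendsto_rpow_atTop (by positivity)).comp tendsto_inv_nhdsGT_zero
    refine h1.congr' ?_
    filter_upwards [self_mem_nhdsWithin] with l hl
    rw [Real.inv_rpow (le_of_lt hl), Real.rpow_neg (le_of_lt hl)]
  have hk' : Tendsto (fun l : ℝ => 4 * l ^ k) (𝓝[>] 0) (𝓝 0) := by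
    have : ContinuousAt (fun l : ℝ => 4 * l ^ k) 0 :=
      continuousAt_const.mul (Real.continuousAt_rpow_const _ _ (Or.inr hk0.le))
    have h := this.tendsto.mono_left (nhdsWithin_le_nhds (s := Set.Ioi 0))
    simpa [Real.zero_rpow hk0.ne'] using h
  filter_upwards [hT.eventually_ge_atTop (max T₀ 1), hk'.eventually_lt_const one_pos,
    self_mem_nhdsWithin, Ioo_mem_nhdsGT (one_pos : (0 : ℝ) < 1)] with l hlT hlD hl hl1 w hprim hwl hw
  have hl0 : 0 < l := hl
  -- The factor 2 makes T ^ (-a) strictly smaller than l, as the nonvanishing of a minor requires.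
  set T : ℝ := 2 * l ^ (-(1 / a)) with hTdef
  have hT0 : 0 < T := by positivity
  have hTge : T₀ ≤ T := by linarith [le_max_left T₀ 1, le_max_right T₀ 1]
  obtain ⟨x, hx, hxl, hxu⟩ := hT₀ T hTge
  have hTa : T ^ (-a) < l := by
    rw [hTdef, Real.mul_rpow (by norm_num) (by positivity), ← Real.rpow_mul hl0.le,
      show -(1 / a) * -a = 1 by field_simp, Real.rpow_one]
    exact mul_lt_of_lt_one_left hl0 (Real.rpow_lt_one_of_one_lt_of_neg (by norm_num) (by linarith))
  have hxpos : 0 < |linForm θ x| := lt_of_lt_of_le (by positivity) hxl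
  have hlγ : l ^ (-(1 / γ)) ≤ l ^ (-(1 / a)) := by
    refine Real.rpow_le_rpow_of_exponent_ge hl0 hl1.2.le ?_
    have : 1 / γ ≤ 1 / a := one_div_le_one_div_of_le ha0 hγ
    linarith
  set D : ℝ := 4 * l ^ k with hDdef
  have hD0 : 0 < D := by positivity
  have hlT2 : 2 * (l * T) = D := by
    rw [hDdef, hTdef, hk, Real.rpow_sub hl0, Real.rpow_one, Real.rpow_neg hl0.le]
    ring
  have hD : ∀ i : Fin n, |linForm θ w * x i.succ - linForm θ x * w i.succ| ≤ D := by
    intro i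
    refine (abs_sub _ _).trans ?_
    rw [abs_mul, abs_mul, hwl, ← hlT2, two_mul]
    refine add_le_add (mul_le_mul_of_nonneg_left (hx i) hl0.le) ?_
    refine mul_le_mul (hxu.trans hTa.le) ?_ (abs_nonneg _) hl0.le
    have := hw i
    have h : 0 < l ^ (-(1 / a)) := by positivity
    linarith
  obtain ⟨i₀, j₀, hij₀⟩ := exists_minor_ne_zero hprim (by rw [hwl]; exact hl1.2)
    (by intro h; rw [h, abs_zero] at hwl; exact hl0.ne hwl) (abs_pos.1 hxpos)
    (by rw [hwl]; exact hxu.trans_lt hTa) (fun i => (hD i).trans_lt hlD)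
  have : Nonempty (Fin n) := ⟨i₀⟩
  -- `exists_defect_le` needs the largest minor, not just a nonzero one.
  obtain ⟨⟨i, j⟩, hmax⟩ := Finite.exists_max
    fun q : Fin n × Fin n => |(w q.1.succ : ℝ) * x q.2.succ - w q.2.succ * x q.1.succ|
  set Δ : ℝ := |(w i.succ : ℝ) * x j.succ - w j.succ * x i.succ| with hΔ
  have hΔ0 : 0 < Δ := (abs_pos.2 hij₀).trans_le (hmax (i₀, j₀))
  have hΔle : Δ ≤ 4 * l ^ (-s) := by
    have h1 : ∀ i j : Fin n, |(w i.succ : ℝ) * x j.succ| ≤ l ^ (-(1 / γ)) * T := fun i j => by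
      rw [abs_mul]
      exact mul_le_mul (hw i) (hx j) (abs_nonneg _) (by positivity)
    calc Δ ≤ l ^ (-(1 / γ)) * T + l ^ (-(1 / γ)) * T :=
          (abs_sub _ _).trans (add_le_add (h1 i j) (h1 j i))
      _ = 4 * l ^ (-s) := by
          rw [hTdef, hs, neg_add, Real.rpow_add hl0]
          ring
  have hn1 : (0 : ℝ) < n - 1 := by linarith
  set R : ℝ := D ^ (1 / ((n : ℝ) - 1)) with hR
  have hR0 : 0 < R := by positivity
  have hR1 : R ≤ 1 := Real.rpow_le_one hD0.le hlD.le (by positivity)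
  have hRD : R ^ (n - 1) = D := by
    rw [← Real.rpow_natCast, hR, ← Real.rpow_mul hD0.le, Nat.cast_sub (by omega), Nat.cast_one,
      one_div_mul_cancel hn1.ne', Real.rpow_one]
  obtain ⟨p, hp, hp0, hpd⟩ := exists_defect_le θ w x hΔ0 hR0 hΔ.symm
    (fun k l => hmax (k, l)) hD hRD
  have hlow' := hlow p hp _ hpd
  set P : ℝ := 8 * l ^ (-s) * R ^ (-((n : ℝ) - 2)) with hP
  have hP0 : 0 < P := by positivity
  have hs0 : 0 < s := by positivity
  have hQ : max 1 |(p 0 : ℝ)| ≤ P := by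
    apply max_le
    · have h1 : 1 ≤ l ^ (-s) := Real.one_le_rpow_of_pos_of_le_one_of_nonpos hl0 hl1.2.le (by linarith)
      have h2 : 1 ≤ R ^ (-((n : ℝ) - 2)) :=
        Real.one_le_rpow_of_pos_of_le_one_of_nonpos hR0 hR1 (by linarith)
      nlinarith
    · refine hp0.trans ?_
      have : R ^ (-((n : ℝ) - 2)) = (R ^ (n - 2))⁻¹ := by
        rw [Real.rpow_neg hR0.le, ← Real.rpow_natCast, Nat.cast_sub hn, Nat.cast_ofNat]
      rw [hP, this, div_eq_mul_inv]
      exact mul_le_mul_of_nonneg_right (by linarith) (by positivity)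
  have h1 : c₀ * P ^ (-e) ≤ (n + 2) * R := by
    refine le_trans ?_ hlow'
    gcongr ?_ * ?_
    exact Real.rpow_le_rpow_of_nonpos (by positivity) hQ (by linarith)
  have h2 : c₀ ≤ (n + 2) * R * P ^ e := by
    rw [Real.rpow_neg hP0.le, ← div_eq_mul_inv, div_le_iff₀ (by positivity)] at h1
    exact h1
  rw [div_le_iff₀ hC0]
  refine h2.trans (le_of_eq ?_)
  have hRP : R * P ^ e = 8 ^ e * l ^ (-s * e) * R ^ (1 - ((n : ℝ) - 2) * e) := by
    rw [hP, Real.mul_rpow (by positivity) (by positivity),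
      Real.mul_rpow (by positivity) (by positivity), ← Real.rpow_mul hl0.le, ← Real.rpow_mul hR0.le,
      sub_eq_add_neg (1 : ℝ), Real.rpow_add hR0, Real.rpow_one, neg_mul, neg_mul]
    ring
  have hRpow : R ^ (1 - ((n : ℝ) - 2) * e) =
      4 ^ ((1 - ((n : ℝ) - 2) * e) / (n - 1)) * l ^ (k * (1 - (n - 2) * e) / (n - 1)) := by
    rw [hR, ← Real.rpow_mul hD0.le, hDdef, Real.mul_rpow (by norm_num) (by positivity),
      ← Real.rpow_mul hl0.le]
    congr 2 <;> ring_nf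
  rw [mul_assoc, hRP, hRpow, hC, sub_eq_add_neg _ (s * e), Real.rpow_add hl0, neg_mul]
  ring

/-- Very small values of the linear form contradict uniformly small ones. -/
theorem UniformlySmall.transference {n : ℕ} (hn : 2 ≤ n) {θ : Fin n → ℝ} {a b γ : ℝ}
    (ha : 1 < a) (hab : a ≤ b) (hγ : a ≤ γ) (hU : UniformlySmall θ a b)
    (hw : ∀ W₀ : ℝ, ∃ W : ℝ, W₀ ≤ W ∧ ∃ w : Fin (n + 1) → ℤ, (∀ i : Fin n, |(w i.succ : ℝ)| ≤ W) ∧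
      0 < |linForm θ w| ∧ |linForm θ w| ≤ W ^ (-γ)) :
    (a - 1) * γ * (a - (n - 2) * (1 + b - a)) ≤ (n - 1) * (a + γ) * (1 + b - a) := by
  obtain ⟨c, hc, hev⟩ := hU.eventually_le_rpow hn ha hab hγ
  have ha0 : 0 < a := by linarith
  have hγ0 : 0 < γ := by linarith
  have hn' : (2 : ℝ) ≤ n := by exact_mod_cast hn
  set E : ℝ := (1 - 1 / a) * (1 - (n - 2) * ((1 + b - a) / a)) / (n - 1)
        - (1 / γ + 1 / a) * ((1 + b - a) / a) with hE
  have hEeq : E = ((a - 1) * γ * (a - (n - 2) * (1 + b - a)) - (n - 1) * (a + γ) * (1 + b - a))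
      / (a ^ 2 * γ * (n - 1)) := by
    have : (n : ℝ) - 1 ≠ 0 := by linarith
    rw [hE]
    field_simp
  by_contra! hcon
  have hE0 : 0 < E := by
    rw [hEeq]
    have : (0 : ℝ) < n - 1 := by linarith
    exact div_pos (by linarith) (by positivity)
  have hsmall : ∀ᶠ l : ℝ in 𝓝[>] 0, l ^ E < c := by
    have h1 : ContinuousAt (fun l : ℝ => l ^ E) 0 :=
      Real.continuousAt_rpow_const _ _ (Or.inr hE0.le)
    have h := h1.tendsto.mono_left (nhdsWithin_le_nhds (s := Set.Ioi 0))
    simp only [Real.zero_rpow hE0.ne'] at h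
    exact h.eventually_lt_const hc
  obtain ⟨d, hd, hdl⟩ := mem_nhdsGT_iff_exists_Ioo_subset.1 (hev.and hsmall)
  have hd0 : 0 < d := hd
  obtain ⟨W₀, hW₀⟩ := ((tendsto_rpow_neg_atTop hγ0).eventually_lt_const hd0).exists_forall_of_atTop
  obtain ⟨W, hWW, w, hwW, hwpos, hwle⟩ := hw (max W₀ 1)
  have hW1 : 1 ≤ W := (le_max_right _ _).trans hWW
  have hW0 : 0 < W := by linarith
  have hwd := hW₀ W ((le_max_left _ _).trans hWW)
  -- Dividing by the content increases neither the coefficients nor the value, so the primitive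
  -- vector still satisfies the size bound, with l = |L(v)|.
  obtain ⟨v, hv, hvprim⟩ := Finset.extract_gcd w (Finset.univ_nonempty (α := Fin (n + 1)))
  set g := Finset.univ.gcd w with hg
  have hwv : ∀ m, w m = g * v m := fun m => hv m (Finset.mem_univ m)
  have hlin : linForm θ w = g * linForm θ v := by
    simp only [linForm, hwv, mul_add, Finset.mul_sum]
    push_cast
    congr 1
    exact Finset.sum_congr rfl fun i _ => by ring
  have hg0 : g ≠ 0 := by
    intro h
    rw [hlin, h] at hwpos
    simp at hwpos
  have hg1 := one_le_abs_intCast hg0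
  have hvpos : 0 < |linForm θ v| := by
    rw [hlin, abs_mul] at hwpos
    exact pos_of_mul_pos_right hwpos (abs_nonneg _)
  have hvw : |linForm θ v| ≤ |linForm θ w| := by
    rw [hlin, abs_mul]
    exact le_mul_of_one_le_left hvpos.le hg1
  have hvW := hvw.trans hwle
  obtain ⟨h1, h2⟩ := hdl ⟨hvpos, hvW.trans_lt hwd⟩
  refine absurd (h1 v hvprim rfl fun i => ?_) (not_le.2 h2)
  have h3 : |(v i.succ : ℝ)| ≤ W := by
    refine le_trans ?_ (hwW i)
    rw [hwv]
    push_cast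
    rw [abs_mul]
    exact le_mul_of_one_le_left (abs_nonneg _) hg1
  refine h3.trans ?_
  calc W = (W ^ (-γ)) ^ (-(1 / γ)) := by
        rw [← Real.rpow_mul hW0.le, show -γ * -(1 / γ) = 1 by field_simp, Real.rpow_one]
    _ ≤ _ := Real.rpow_le_rpow_of_nonpos hvpos hvW (by
        have : 0 < 1 / γ := by positivity
        linarith)

/-! ### From the sequence to uniform smallness -/

theorem infDist_submodule_eq {E : Type*} [NormedAddCommGroup E] [InnerProductSpace ℝ E]
    (K : Submodule ℝ E) [K.HasOrthogonalProjection] (x : E) :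
    Metric.infDist x (K : Set E) = ‖x - K.starProjection x‖ := by
  rw [Metric.infDist_eq_iInf, Submodule.starProjection_minimal]
  simp only [dist_eq_norm]
  rfl

namespace Nesterenko

theorem inner_point_intPoint {n : ℕ} (θ : Fin n → ℝ) (x : Fin (n + 1) → ℤ) :
    inner ℝ (point θ) (intPoint x) = linForm θ x := by
  simp [point, intPoint, PiLp.inner_apply, Fin.sum_univ_succ, linForm, mul_comm]

theorem one_le_norm_point {n : ℕ} (θ : Fin n → ℝ) : 1 ≤ ‖point θ‖ := by
  have := PiLp.norm_apply_le (point θ) 0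
  simpa [point] using this

theorem h_intPoint {n : ℕ} (θ : Fin n → ℝ) (x : Fin (n + 1) → ℤ) :
    h θ (intPoint x) = |linForm θ x| / ‖point θ‖ := by
  have hN : 0 < ‖point θ‖ := by linarith [one_le_norm_point θ]
  rw [h, infDist_submodule_eq, Submodule.starProjection_orthogonal]
  simp only [_root_.sub_apply, ContinuousLinearMap.id_apply, sub_sub_cancel, line]
  rw [Submodule.starProjection_singleton, inner_point_intPoint, norm_smul]
  simp only [RCLike.ofReal_real_eq_id, id, norm_div, norm_pow, Real.norm_eq_abs,
    abs_norm]
  field_simp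

theorem norm_intPoint_le {n : ℕ} (θ : Fin n → ℝ) (x : Fin (n + 1) → ℤ) :
    ‖intPoint x‖ ≤ r θ (intPoint x) + h θ (intPoint x) := by
  rw [r, h, infDist_submodule_eq, infDist_submodule_eq, Submodule.starProjection_orthogonal]
  simp only [_root_.sub_apply, ContinuousLinearMap.id_apply, sub_sub_cancel]
  refine le_trans (le_of_eq ?_) (norm_add_le _ _)
  simp

theorem abs_apply_le_norm_intPoint {n : ℕ} (x : Fin (n + 1) → ℤ) (i : Fin (n + 1)) :
    |(x i : ℝ)| ≤ ‖intPoint x‖ := by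
  simpa [intPoint] using PiLp.norm_apply_le (intPoint x) i

/-- The first t k to reach S has a predecessor below S, and the limsup condition bounds log (t k) by
(1 + η) times the predecessor's logarithm. -/
theorem Hypothesis.exists_mem_Icc {n : ℕ} {θ : Fin n → ℝ} {α β c₁ c₂ : ℝ} {t : ℕ → ℝ}
    (H : Hypothesis θ α β c₁ c₂ t) {η : ℝ} (hη : 0 < η) (k₀ : ℕ) :
    ∃ S₀ : ℝ, ∀ S, S₀ ≤ S → ∃ k, k₀ ≤ k ∧ S ≤ t k ∧ t k ≤ S ^ (1 + η) := by
  have h1 : ∀ᶠ k in atTop, Real.log (t (k + 1)) / Real.log (t k) < 1 + η := by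
    have hlt : limsup (fun k => ((Real.log (t (k + 1)) / Real.log (t k) : ℝ) : EReal)) atTop
        < ((1 + η : ℝ) : EReal) := by
      rw [H.t_limsup]
      exact_mod_cast (by linarith : (1 : ℝ) < 1 + η)
    filter_upwards [eventually_lt_of_limsup_lt hlt] with k hk
    exact_mod_cast hk
  obtain ⟨k₁, hk₁⟩ := ((h1.and (H.t_tendsto.eventually_gt_atTop 1)).and
    (eventually_ge_atTop k₀)).exists_forall_of_atTop
  refine ⟨t k₁ + 1, fun S hS => ?_⟩
  have hex : ∃ k, k₁ ≤ k ∧ S ≤ t k :=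
    ((eventually_ge_atTop k₁).and (H.t_tendsto.eventually_ge_atTop S)).exists
  classical
  obtain ⟨hk, hSk⟩ := Nat.find_spec hex
  have hmin := fun m => Nat.find_min hex (m := m)
  set k := Nat.find hex
  have hne : k ≠ k₁ := by
    rintro h
    rw [h] at hSk
    linarith
  obtain ⟨m, hm⟩ : ∃ m, k = m + 1 := ⟨k - 1, by omega⟩
  have hm1 : k₁ ≤ m := by omega
  have htm : t m < S := by
    by_contra! hcon
    exact hmin m (by omega) ⟨hm1, hcon⟩
  obtain ⟨⟨hlog, hone⟩, hkk⟩ := hk₁ m hm1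
  refine ⟨k, by omega, hSk, ?_⟩
  have hS0 : 0 < S := by linarith
  have hlm : 0 < Real.log (t m) := Real.log_pos hone
  rw [div_lt_iff₀ hlm] at hlog
  have hls : Real.log (t m) ≤ Real.log S := Real.log_le_log (by linarith) htm.le
  rw [hm, ← Real.log_le_log_iff (H.t_pos _) (by positivity), Real.log_rpow hS0]
  exact hlog.le.trans (by gcongr)

theorem eventually_mul_rpow_le {C p q : ℝ} (hpq : p < q) :
    ∀ᶠ T : ℝ in atTop, C * T ^ p ≤ T ^ q := by
  filter_upwards [(tendsto_rpow_atTop (sub_pos.2 hpq)).eventually_ge_atTop C,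
    eventually_gt_atTop 0] with T hT hT0
  calc C * T ^ p ≤ T ^ (q - p) * T ^ p := by gcongr
    _ = T ^ q := by rw [← Real.rpow_add hT0, sub_add_cancel]

/-- Choosing t k as a power of T slightly below 1 leaves room for every constant, at the cost of
moving α and β to a and b. -/
theorem Hypothesis.uniformlySmall {n : ℕ} {θ : Fin n → ℝ} {α β c₁ c₂ : ℝ} {t : ℕ → ℝ}
    (H : Hypothesis θ α β c₁ c₂ t) {a b : ℝ} (ha0 : 0 < a) (ha : a < α) (hb : β < b) :
    UniformlySmall θ a b := by
  have hα := H.alpha_pos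
  have hβ : 0 < β := hα.trans_le H.alpha_le_beta
  have hc₁ := H.c₁_pos
  have hc₂ := H.c₂_pos
  set N := ‖point θ‖
  have hN : 1 ≤ N := one_le_norm_point θ
  have hN0 : 0 < N := by linarith
  obtain ⟨k₀, hk₀⟩ := (H.exists_point.and
    (H.t_tendsto.eventually_ge_atTop 1)).exists_forall_of_atTop
  -- With a / α < μ < ν < 1 the index k will satisfy T ^ μ ≤ t k ≤ T ^ ν: the lower end gives the
  -- exponent a, the upper end the exponent b and the size bound T.
  obtain ⟨μ, hμa, hμ1⟩ := exists_between ((div_lt_one hα).2 ha)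
  obtain ⟨ν, hμν, hν1⟩ := exists_between hμ1
  have hμ0 : 0 < μ := (div_pos ha0 hα).trans hμa
  have hν0 : 0 < ν := hμ0.trans hμν
  have hη : 0 < ν / μ - 1 := sub_pos.2 ((one_lt_div hμ0).2 hμν)
  obtain ⟨S₀, hS₀⟩ := H.exists_mem_Icc hη k₀
  rw [div_lt_iff₀ hα] at hμa
  have e1 : ∀ᶠ T : ℝ in atTop, (1 + c₂) * T ^ ν ≤ T ^ (1 : ℝ) := eventually_mul_rpow_le hν1
  have e2 : ∀ᶠ T : ℝ in atTop, (N * c₂) * T ^ (-(μ * α)) ≤ T ^ (-a) :=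
    eventually_mul_rpow_le (by linarith)
  have e3 : ∀ᶠ T : ℝ in atTop, (N * c₁)⁻¹ * T ^ (-b) ≤ T ^ (-(ν * β)) :=
    eventually_mul_rpow_le (by nlinarith)
  obtain ⟨T₀, hT₀⟩ := (((e1.and e2).and (e3.and (eventually_ge_atTop 1))).and
    ((tendsto_rpow_atTop hμ0).eventually_ge_atTop S₀)).exists_forall_of_atTop
  refine ⟨T₀, fun T hT => ?_⟩
  obtain ⟨⟨⟨h1, h2⟩, h3, hT1⟩, hTS⟩ := hT₀ T hT
  have hT0 : 0 < T := by linarith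
  obtain ⟨k, hk, hlow, hup⟩ := hS₀ _ hTS
  rw [← Real.rpow_mul hT0.le, show μ * (1 + (ν / μ - 1)) = ν by field_simp; ring] at hup
  obtain ⟨⟨x, hr, hhl, hhu⟩, ht1⟩ := hk₀ k hk
  have hlin : |linForm θ x| = N * h θ (intPoint x) := by
    have : ‖point θ‖ ≠ 0 := hN0.ne'
    rw [h_intPoint]
    change _ = ‖point θ‖ * _
    field_simp
  have ht0 := H.t_pos k
  have htα : t k ^ (-α) ≤ T ^ (-(μ * α)) := by
    rw [show -(μ * α) = μ * -α by ring, Real.rpow_mul hT0.le]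
    exact Real.rpow_le_rpow_of_nonpos (by positivity) hlow (by linarith)
  have htβ : T ^ (-(ν * β)) ≤ t k ^ (-β) := by
    rw [show -(ν * β) = ν * -β by ring, Real.rpow_mul hT0.le]
    exact Real.rpow_le_rpow_of_nonpos ht0 hup (by linarith)
  refine ⟨x, fun i => ?_, ?_, ?_⟩
  · refine (abs_apply_le_norm_intPoint x _).trans ((norm_intPoint_le θ x).trans ?_)
    have htα1 : t k ^ (-α) ≤ t k :=
      (Real.rpow_le_one_of_one_le_of_nonpos ht1 (by linarith)).trans ht1
    rw [Real.rpow_one] at h1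
    calc r θ (intPoint x) + h θ (intPoint x) ≤ t k + c₂ * t k :=
          add_le_add hr (hhu.trans (by gcongr))
      _ = (1 + c₂) * t k := by ring
      _ ≤ (1 + c₂) * T ^ ν := by gcongr
      _ ≤ T := h1
  · rw [hlin]
    rw [inv_mul_le_iff₀ (by positivity)] at h3
    calc T ^ (-b) ≤ N * c₁ * t k ^ (-β) := h3.trans (by gcongr)
      _ = N * (c₁ * t k ^ (-β)) := by ring
      _ ≤ _ := by gcongr
  · rw [hlin]
    calc N * h θ (intPoint x) ≤ N * (c₂ * t k ^ (-α)) := by gcongr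
      _ ≤ N * (c₂ * T ^ (-(μ * α))) := by gcongr
      _ ≤ T ^ (-a) := by rw [← mul_assoc]; exact h2

/-! ### The bound for the exponent -/

/-- If the linear form is small at vectors of size `W` for arbitrarily large `W`, the exponent
satisfies the polynomial inequality of the criterion. -/
theorem Hypothesis.transference {n : ℕ} (hn : 2 ≤ n) {θ : Fin n → ℝ} {α β c₁ c₂ : ℝ} {t : ℕ → ℝ}
    (H : Hypothesis θ α β c₁ c₂ t) (hα : 1 < α) (γ : ℝ → ℝ) (hγc : ContinuousAt γ 0)
    (hγ : ∀ s, 0 < s → s < α - 1 → α - s ≤ γ s ∧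
      ∀ W₀ : ℝ, ∃ W : ℝ, W₀ ≤ W ∧ ∃ w : Fin (n + 1) → ℤ, (∀ i : Fin n, |(w i.succ : ℝ)| ≤ W) ∧
      0 < |linForm θ w| ∧ |linForm θ w| ≤ W ^ (-γ s)) :
    (α - 1) * γ 0 * (α - (n - 2) * (1 + β - α)) ≤ (n - 1) * (α + γ 0) * (1 + β - α) := by
  -- Use a = α - s and b = β + s, then let s → 0⁺.
  have key : ∀ᶠ s in 𝓝[>] (0 : ℝ), (α - s - 1) * γ s * (α - s - (n - 2) * (1 + (β + s) - (α - s)))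
      ≤ (n - 1) * (α - s + γ s) * (1 + (β + s) - (α - s)) := by
    filter_upwards [Ioo_mem_nhdsGT (sub_pos.2 hα)] with s hs
    have hab := H.alpha_le_beta
    exact (H.uniformlySmall (by linarith [hs.2]) (by linarith [hs.1]) (by linarith [hs.1])).transference
      hn (by linarith [hs.2]) (by linarith [hs.1]) (hγ s hs.1 hs.2).1 (hγ s hs.1 hs.2).2
  have c1 : ContinuousAt (fun s : ℝ => (α - s - 1) * γ s *
      (α - s - (n - 2) * (1 + (β + s) - (α - s)))) 0 := by fun_prop
  have c2 : ContinuousAt (fun s : ℝ => ((n : ℝ) - 1) * (α - s + γ s) *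
      (1 + (β + s) - (α - s))) 0 := by fun_prop
  have := le_of_tendsto_of_tendsto (c1.tendsto.mono_left (nhdsWithin_le_nhds (s := Set.Ioi 0)))
    (c2.tendsto.mono_left (nhdsWithin_le_nhds (s := Set.Ioi 0))) key
  simpa using this

theorem one_lt_of_lt_div {n : ℕ} (hn : 2 ≤ n) {α β : ℝ} (hα : 0 < α) (hab : α ≤ β)
    (hκ : (n : ℝ) - 1 < ((α - 1) * (1 + β)) / (α * (1 + β - α))) :
    1 < α ∧ 0 < (α - 1) * (1 + β) - ((n : ℝ) - 1) * α * (1 + β - α) := by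
  have hn' : (2 : ℝ) ≤ n := by exact_mod_cast hn
  have hm : 0 < α * (1 + β - α) := mul_pos hα (by linarith)
  rw [lt_div_iff₀ hm] at hκ
  have h1 : 0 < (α - 1) * (1 + β) := lt_of_le_of_lt (by
    have : (0 : ℝ) ≤ n - 1 := by linarith
    positivity) hκ
  have h2 := pos_of_mul_pos_left h1 (by linarith)
  exact ⟨by linarith, by linarith⟩

theorem linForm_ne_zero {n : ℕ} {θ : Fin n → ℝ}
    (hθ : LinearIndependent ℚ (Fin.cons 1 θ : Fin (n + 1) → ℝ)) {x : Fin (n + 1) → ℤ}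
    (hx : x ≠ 0) : linForm θ x ≠ 0 := by
  intro h0
  apply hx
  ext i
  have := Fintype.linearIndependent_iff.1 hθ (fun i => (x i : ℚ)) (by
    rw [← h0, Fin.sum_univ_succ]
    simp [linForm, Rat.smul_def, mul_comm]) i
  exact_mod_cast this

theorem Hypothesis.omega_le {n : ℕ} (hn : 2 ≤ n) {θ : Fin n → ℝ}
    (hθ : LinearIndependent ℚ (Fin.cons 1 θ : Fin (n + 1) → ℝ)) {α β c₁ c₂ : ℝ} {t : ℕ → ℝ}
    (H : Hypothesis θ α β c₁ c₂ t)
    (hκ : (n : ℝ) - 1 < ((α - 1) * (1 + β)) / (α * (1 + β - α))) :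
    omega θ ≤ (((((n : ℝ) - 1) * α * (1 + β - α)) /
      ((α - 1) * (1 + β) - ((n : ℝ) - 1) * α * (1 + β - α)) : ℝ) : EReal) := by
  obtain ⟨hα, hden⟩ := one_lt_of_lt_div hn H.alpha_pos H.alpha_le_beta hκ
  have hab := H.alpha_le_beta
  -- The inequality is affine in γ; collecting terms, the coefficient of γ is exactly the
  -- denominator, positive by hypothesis.
  have hfinish : ∀ γ : ℝ,
      (α - 1) * γ * (α - (n - 2) * (1 + β - α)) ≤ (n - 1) * (α + γ) * (1 + β - α) →
      γ ≤ (((n : ℝ) - 1) * α * (1 + β - α)) /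
        ((α - 1) * (1 + β) - ((n : ℝ) - 1) * α * (1 + β - α)) := by
    intro γ hγ
    rw [le_div_iff₀ hden]
    linarith
  -- Transference requires γ ≥ a. Feeding it the uniformly small forms themselves as w shows that α
  -- is below the bound, which settles every γ ≤ α.
  have hαle := hfinish α (by
    have := H.transference hn hα (fun s => α - s) (by fun_prop) fun s hs hs1 => ⟨le_rfl, ?_⟩
    · simpa using this
    · intro W₀
      obtain ⟨T₀, hT₀⟩ := H.uniformlySmall (a := α - s) (by linarith) (by linarith)
        (lt_add_one β)
      have hpos : 0 < max (max W₀ T₀) 1 := by positivity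
      obtain ⟨x, hx, hl, hu⟩ := hT₀ (max (max W₀ T₀) 1)
        ((le_max_right _ _).trans (le_max_left _ _))
      exact ⟨_, (le_max_left _ _).trans (le_max_left _ _), x, hx,
        lt_of_lt_of_le (by positivity) hl, hu⟩)
  refine sSup_le ?_
  rintro _ ⟨γ, hγ, rfl⟩
  refine EReal.coe_le_coe_iff.2 ?_
  rcases le_total γ α with h | h
  · exact h.trans hαle
  · refine hfinish γ (H.transference hn hα (fun _ => γ) (by fun_prop) fun s hs hs1 =>
      ⟨by linarith, fun W₀ => ?_⟩)
    obtain ⟨W, hW, w, hw1, hw2, hw3⟩ := (frequently_atTop.1 hγ) W₀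
    refine ⟨W, hW, w, fun i => ?_, ?_, hw1⟩
    · exact (norm_le_pi_norm (fun i : Fin n => (w i.succ : ℝ)) i).trans hw3
    · refine abs_pos.2 (linForm_ne_zero hθ ?_)
      rintro rfl
      exact absurd hw2 (by simp [← Pi.zero_def])

end Nesterenko

/-! ### Rational hyperplanes: normals, heights and angles -/

namespace Nesterenko

theorem mem_intLattice_iff {n : ℕ} {x : Space n} :
    x ∈ intLattice n ↔ ∃ z : Fin (n + 1) → ℤ, intPoint z = x := by
  have h := (EuclideanSpace.basisFun (Fin (n + 1)) ℝ).toBasis.mem_span_iff_repr_mem ℤ x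
  rw [OrthonormalBasis.coe_toBasis] at h
  rw [intLattice, h]
  constructor
  · intro hx
    choose z hz using hx
    refine ⟨z, ?_⟩
    ext i
    simpa [intPoint] using hz i
  · rintro ⟨z, rfl⟩ i
    exact ⟨z i, by simp [intPoint]⟩

instance discreteTopology_intLattice (n : ℕ) : DiscreteTopology (intLattice n) := by
  have : intLattice n = Submodule.span ℤ
      (Set.range (EuclideanSpace.basisFun (Fin (n + 1)) ℝ).toBasis) := by
    rw [OrthonormalBasis.coe_toBasis, intLattice]
  rw [this]
  infer_instance

instance discreteTopology_latticeIn {n : ℕ} (L : Submodule ℝ (Space n)) :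
    DiscreteTopology (latticeIn L) :=
  ZLattice.comap_discreteTopology ℝ (intLattice n) (e := L.subtype) continuous_subtype_val
    L.injective_subtype

/-- Clearing denominators turns each rational point of L into a lattice point, so the lattice spans
L. -/
theorem IsRational.isZLattice {n : ℕ} {L : Submodule ℝ (Space n)} (hL : IsRational L) :
    IsZLattice ℝ (latticeIn L) := by
  refine ⟨?_⟩
  have hle : L ≤ (Submodule.span ℝ (latticeIn L : Set L)).map L.subtype := by
    conv_lhs => rw [← hL]
    refine Submodule.span_le.2 ?_
    rintro x ⟨hx, hq⟩
    choose q hq using hq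
    set N : ℕ := ∏ i, (q i).den with hN
    have hN0 : (N : ℝ) ≠ 0 := by
      rw [Nat.cast_ne_zero, hN]
      exact Finset.prod_ne_zero_iff.2 fun i _ => (q i).den_ne_zero
    have hint : (N : ℝ) • x ∈ intLattice n := by
      refine mem_intLattice_iff.2 ⟨fun i => (∏ j ∈ Finset.univ.erase i, ((q j).den : ℤ)) * (q i).num, ?_⟩
      ext i
      have h1 : (q i : ℝ) * (q i).den = (q i).num := by exact_mod_cast Rat.mul_den_eq_num (q i)
      have h2 : (N : ℝ) = (q i).den * ∏ j ∈ Finset.univ.erase i, ((q j).den : ℝ) := by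
        rw [Finset.mul_prod_erase _ (fun j => ((q j).den : ℝ)) (Finset.mem_univ i), hN]
        push_cast
        rfl
      simp only [intPoint, PiLp.smul_apply, smul_eq_mul, hq i]
      push_cast
      rw [h2, ← h1]
      ring
    refine ⟨⟨x, hx⟩, ?_, rfl⟩
    have hmem : (⟨(N : ℝ) • x, L.smul_mem _ hx⟩ : L) ∈ latticeIn L := hint
    have := Submodule.smul_mem (Submodule.span ℝ (latticeIn L : Set L)) (N : ℝ)⁻¹
      (Submodule.subset_span hmem)
    have heq : (⟨x, hx⟩ : L) = (N : ℝ)⁻¹ • ⟨(N : ℝ) • x, L.smul_mem _ hx⟩ := by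
      ext1
      simp [smul_smul, inv_mul_cancel₀ hN0]
    rw [heq]
    exact this
  rw [eq_top_iff]
  rintro ⟨x, hx⟩ -
  obtain ⟨y, hy, hyx⟩ := hle hx
  have : y = ⟨x, hx⟩ := Subtype.ext hyx
  exact this ▸ hy

/-- The determinant of vectors of a hyperplane and one more vector, in an orthonormal basis. -/
theorem det_cons_of_orthonormalBasis {n : ℕ} {L : Submodule ℝ (Space n)}
    (e : OrthonormalBasis (Fin n) ℝ L) (f : OrthonormalBasis (Fin (n + 1)) ℝ (Space n))
    (hf0 : f 0 ∈ Lᗮ) (hf : ∀ i, f i.succ = e i) (x : Space n) (v : Fin n → L) :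
    f.toBasis.det (Fin.cons x fun i => (v i : Space n)) = inner ℝ (f 0) x * e.toBasis.det v := by
  rw [Module.Basis.det_apply, Matrix.det_succ_row_zero, Fin.sum_univ_succ, Finset.sum_eq_zero]
  · simp only [Fin.val_zero, pow_zero, one_mul, add_zero, Module.Basis.toMatrix_apply,
      Fin.cons_zero, OrthonormalBasis.coe_toBasis_repr_apply, OrthonormalBasis.repr_apply_apply,
      Module.Basis.det_apply]
    congr 2
    ext i j
    simp [Module.Basis.toMatrix_apply, OrthonormalBasis.coe_toBasis_repr_apply,
      OrthonormalBasis.repr_apply_apply, hf]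
  · intro j _
    have : inner ℝ (f 0) (v j : Space n) = 0 :=
      Submodule.inner_left_of_mem_orthogonal (v j).2 hf0
    simp [Module.Basis.toMatrix_apply, OrthonormalBasis.coe_toBasis_repr_apply,
      OrthonormalBasis.repr_apply_apply, this]

theorem exists_adapted_orthonormalBasis {n : ℕ} {L : Submodule ℝ (Space n)}
    (hL : Module.finrank ℝ L = n) :
    ∃ (e : OrthonormalBasis (Fin n) ℝ L) (f : OrthonormalBasis (Fin (n + 1)) ℝ (Space n)),
      f 0 ∈ Lᗮ ∧ ∀ i, f i.succ = e i := by
  set e := (stdOrthonormalBasis ℝ L).reindex (finCongr hL)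
  have hfin : Module.finrank ℝ Lᗮ = 1 := by
    have := L.finrank_add_finrank_orthogonal
    rw [hL, finrank_euclideanSpace_fin] at this
    omega
  set u := (stdOrthonormalBasis ℝ Lᗮ).reindex (finCongr hfin)
  have hon : Orthonormal ℝ (Fin.cons (u 0 : Space n) fun i => (e i : Space n) :
      Fin (n + 1) → Space n) := by
    have hu : ‖(u 0 : Space n)‖ = 1 := u.orthonormal.1 0
    have he : ∀ i j, inner ℝ (e i : Space n) (e j : Space n) = if i = j then (1 : ℝ) else 0 :=
      fun i j => orthonormal_iff_ite.1 e.orthonormal i j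
    have h1 : ∀ i, inner ℝ (u 0 : Space n) (e i : Space n) = 0 := fun i =>
      Submodule.inner_left_of_mem_orthogonal (e i).2 (u 0).2
    have h2 : ∀ i, inner ℝ (e i : Space n) (u 0 : Space n) = 0 := fun i =>
      Submodule.inner_right_of_mem_orthogonal (e i).2 (u 0).2
    rw [orthonormal_iff_ite]
    intro i j
    refine Fin.cases ?_ (fun i => ?_) i <;> refine Fin.cases ?_ (fun j => ?_) j
    · simp [hu]
    · simp [h1, (Fin.succ_ne_zero j).symm]
    · simp [h2]
    · simp [he]
  set B := basisOfOrthonormalOfCardEqFinrank hon (by simp)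
  have hB : ⇑B = Fin.cons (u 0 : Space n) fun i => (e i : Space n) :=
    coe_basisOfOrthonormalOfCardEqFinrank hon (by simp)
  refine ⟨e, B.toOrthonormalBasis (by rw [hB]; exact hon), ?_, fun i => ?_⟩
  · rw [Module.Basis.coe_toOrthonormalBasis, hB]
    exact (u 0).2
  · rw [Module.Basis.coe_toOrthonormalBasis, hB]
    rfl

theorem det_basisFun_intPoint {n : ℕ} (z : Fin (n + 1) → Fin (n + 1) → ℤ) :
    (EuclideanSpace.basisFun (Fin (n + 1)) ℝ).toBasis.det (fun i => intPoint (z i)) =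
      ((Matrix.of z).det : ℝ) := by
  rw [Module.Basis.det_apply, ← Matrix.det_transpose, ← eq_intCast (Int.castRingHom ℝ),
    RingHom.map_det]
  congr 1

/-- A rational hyperplane has an integer normal vector of length equal to its height. -/
theorem IsRational.exists_normal {n : ℕ} {L : Submodule ℝ (Space n)} (hL : IsRational L)
    (hn : Module.finrank ℝ L = n) :
    ∃ q : Fin (n + 1) → ℤ, q ≠ 0 ∧ intPoint q ∈ Lᗮ ∧ ‖intPoint q‖ = height L := by
  have := hL.isZLattice
  obtain ⟨e, f, hf0, hf⟩ := exists_adapted_orthonormalBasis hn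
  have : Module.Free ℤ (latticeIn L) := ZLattice.module_free ℝ _
  have : Module.Finite ℤ (latticeIn L) := ZLattice.module_finite ℝ _
  have hrank : Module.finrank ℤ (latticeIn L) = n := by rw [ZLattice.rank ℝ, hn]
  set b := (Module.finBasis ℤ (latticeIn L)).reindex (finCongr hrank)
  let _ : MeasureTheory.MeasureSpace L := measureSpaceOfInnerProductSpace
  have hcov : height L = |e.toBasis.det fun i => (b i : L)| := by
    rw [height, ZLattice.covolume_eq_det_mul_measureReal (latticeIn L) _ b e.toBasis,
      MeasureTheory.measureReal_congr (ZSpan.fundamentalDomain_ae_parallelepiped e.toBasis _),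
      MeasureTheory.measureReal_def, OrthonormalBasis.coe_toBasis, e.volume_parallelepiped]
    simp
    rfl
  have hint : ∀ i, ∃ z : Fin (n + 1) → ℤ, intPoint z = ((b i : L) : Space n) := fun i =>
    mem_intLattice_iff.1 (b i).2
  choose z hz using hint
  set std := EuclideanSpace.basisFun (Fin (n + 1)) ℝ
  set d := e.toBasis.det fun i => (b i : L)
  set σ := std.toBasis.det f
  have hσ : |σ| = 1 := OrthonormalBasis.det_to_matrix_orthonormalBasis std f
  have hD : ∀ x : Fin (n + 1) → ℤ,
      ((Matrix.of (Fin.cons x z : Fin (n + 1) → Fin (n + 1) → ℤ)).det : ℝ)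
        = σ * d * inner ℝ (f 0) (intPoint x) := by
    intro x
    have h1 := std.toBasis.det.eq_smul_basis_det f.toBasis
    have h2 : (fun i => intPoint ((Fin.cons x z : Fin (n + 1) → Fin (n + 1) → ℤ) i))
        = Fin.cons (intPoint x) fun i => ((b i : L) : Space n) := by
      ext1 i
      refine Fin.cases rfl (fun i => ?_) i
      simp [hz]
    rw [← det_basisFun_intPoint, h2, h1, AlternatingMap.smul_apply,
      det_cons_of_orthonormalBasis e f hf0 hf, OrthonormalBasis.coe_toBasis, smul_eq_mul]
    ring
  -- The generalized cross product of a lattice basis. Its coordinates are integer determinants, and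
  -- by `hD` it is ±d times the unit normal `f 0`, where |d| is the covolume.
  set q : Fin (n + 1) → ℤ := fun i =>
    (Matrix.of (Fin.cons (Pi.single i 1) z : Fin (n + 1) → Fin (n + 1) → ℤ)).det with hq
  have hqf : intPoint q = (σ * d) • f 0 := by
    ext i
    have h1 : intPoint (Pi.single i 1 : Fin (n + 1) → ℤ) = EuclideanSpace.single i (1 : ℝ) := by
      ext j
      simp [intPoint, Pi.single_apply]
    have := hD (Pi.single i 1)
    rw [h1, EuclideanSpace.inner_single_right] at this
    simpa [intPoint, hq] using this
  have hnorm : ‖intPoint q‖ = height L := by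
    rw [hqf, norm_smul, f.orthonormal.1 0, mul_one, Real.norm_eq_abs, abs_mul, hσ, one_mul, hcov]
  refine ⟨q, ?_, ?_, hnorm⟩
  · intro h0
    have hpos : 0 < height L := ZLattice.covolume_pos (latticeIn L) _
    rw [← hnorm, h0] at hpos
    have : intPoint (0 : Fin (n + 1) → ℤ) = 0 := by ext; simp [intPoint]
    simp [this] at hpos
  · rw [hqf]
    exact Submodule.smul_mem _ _ hf0

/-- Only the component s' of (1, θ) orthogonal to L contributes to L(q), so Cauchy–Schwarz bounds
|L(q)| by ‖q‖ ‖s'‖. The tangent is ‖s'‖ / ‖s‖, with ‖s‖ ≤ ‖(1, θ)‖. -/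
theorem ofReal_le_phi {n : ℕ} (θ : Fin n → ℝ) (L : Submodule ℝ (Space n))
    {q : Fin (n + 1) → ℤ} (hq : intPoint q ∈ Lᗮ) :
    ENNReal.ofReal (|linForm θ q| / (‖intPoint q‖ * ‖point θ‖)) ≤ phi θ L := by
  rw [phi]
  split_ifs with hangle
  · exact le_top
  refine ENNReal.ofReal_le_ofReal ?_
  set s := L.starProjection (point θ) with hs
  set s' := point θ - s with hs'
  have hsL : s ∈ L := L.starProjection_apply_mem _
  have hs'L : s' ∈ Lᗮ := L.sub_starProjection_mem_orthogonal _
  have hpt : point θ = s + s' := by simp [hs']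
  have hs0 : 0 < ‖s‖ := by
    rw [norm_pos_iff]
    intro h0
    apply hangle
    rw [angle, ← hs, h0, InnerProductGeometry.angle_zero_right]
  have hort : inner ℝ s s' = 0 := Submodule.inner_right_of_mem_orthogonal hsL hs'L
  have htan : Real.tan (angle θ L) = ‖s'‖ / ‖s‖ := by
    rw [angle, ← hs, InnerProductGeometry.angle_comm, hpt,
      InnerProductGeometry.tan_angle_add_of_inner_eq_zero hort]
  have hlin : |linForm θ q| ≤ ‖intPoint q‖ * ‖s'‖ := by
    rw [← inner_point_intPoint, hpt, inner_add_left,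
      Submodule.inner_right_of_mem_orthogonal hsL hq, zero_add, mul_comm]
    exact abs_real_inner_le_norm _ _
  have hle : ‖s‖ ≤ ‖point θ‖ := by
    have := norm_add_sq_eq_norm_sq_add_norm_sq_real hort
    rw [← hpt] at this
    nlinarith [norm_nonneg s, norm_nonneg s', norm_nonneg (point θ)]
  rw [htan]
  rcases (norm_nonneg (intPoint q)).eq_or_lt with h0 | h0
  · rw [← h0, zero_mul, div_zero]
    positivity
  calc |linForm θ q| / (‖intPoint q‖ * ‖point θ‖)
      ≤ ‖intPoint q‖ * ‖s'‖ / (‖intPoint q‖ * ‖s‖) := by gcongr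
    _ = ‖s'‖ / ‖s‖ := by field_simp

/-- Above the exponent, the linear form is bounded below at all integer points. -/
theorem exists_rpow_le_linForm {n : ℕ} {θ : Fin n → ℝ} {γ : ℝ} (hγ0 : 0 ≤ γ)
    (hγ : omega θ < γ) :
    ∃ c : ℝ, 0 < c ∧ ∀ q : Fin (n + 1) → ℤ, q ≠ 0 → c * ‖intPoint q‖ ^ (-γ) ≤ |linForm θ q| := by
  have hnot : ¬ ∃ᶠ t : ℝ in atTop, ∃ x : Fin (n + 1) → ℤ,
      |linForm θ x| ≤ t ^ (-γ) ∧ 0 < ‖(fun i : Fin n => (x i.succ : ℝ))‖ ∧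
        ‖(fun i : Fin n => (x i.succ : ℝ))‖ ≤ t := fun h =>
    not_le.2 hγ (le_sSup ⟨γ, h, rfl⟩)
  rw [not_frequently] at hnot
  obtain ⟨t₀, ht₀⟩ := (hnot.and (eventually_ge_atTop 1)).exists_forall_of_atTop
  have ht1 := (ht₀ t₀ le_rfl).2
  have ht00 : 0 < t₀ := by linarith
  refine ⟨t₀ ^ (-γ), by positivity, fun q hq => ?_⟩
  have hq1 : 1 ≤ ‖intPoint q‖ := by
    obtain ⟨i, hi⟩ := Function.ne_iff.1 hq
    exact (one_le_abs_intCast hi).trans (abs_apply_le_norm_intPoint q i)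
  rw [← Real.mul_rpow ht00.le (by positivity)]
  set y : Fin n → ℝ := fun i => (q i.succ : ℝ) with hy
  rcases (norm_nonneg y).eq_or_lt with h0 | h0
  · have hz := norm_eq_zero.1 h0.symm
    have hz' : ∀ i : Fin n, q i.succ = 0 := fun i =>
      Int.cast_eq_zero.1 (congrFun hz i)
    have hq0 : q 0 ≠ 0 := fun h => hq (funext fun m => Fin.cases h hz' m)
    have hlin : linForm θ q = q 0 := by simp [linForm, hz']
    rw [hlin]
    refine le_trans ?_ (one_le_abs_intCast hq0)
    exact Real.rpow_le_one_of_one_le_of_nonpos (one_le_mul_of_one_le_of_one_le ht1 hq1)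
      (by linarith)
  · have hyq : ‖y‖ ≤ ‖intPoint q‖ :=
      (pi_norm_le_iff_of_nonneg (by positivity)).2 fun i => abs_apply_le_norm_intPoint q _
    -- This choice of t is admissible for q and at most t₀ ‖q‖, whence the constant t₀ ^ (-γ).
    have h1 := (ht₀ (max t₀ ‖y‖) (le_max_left _ _)).1
    push Not at h1
    have h2 : ¬ |linForm θ q| ≤ (max t₀ ‖y‖) ^ (-γ) := fun h =>
      absurd (h1 q h h0) (not_lt.2 (le_max_right _ _))
    refine le_trans ?_ (not_le.1 h2).le
    refine Real.rpow_le_rpow_of_nonpos (by positivity) (max_le ?_ ?_) (by linarith)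
    · exact le_mul_of_one_le_right ht00.le hq1
    · exact hyq.trans (le_mul_of_one_le_left (by positivity) ht1)

end Nesterenko

/-! ### The criterion -/

theorem proposition4 (n : ℕ) (hn : 2 ≤ n) (θ : Fin n → ℝ)
    (hθ : LinearIndependent ℚ (Fin.cons 1 θ : Fin (n + 1) → ℝ)) (ε : ℝ) (hε : 0 < ε) :
    ∃ c : ℝ, 0 < c ∧
      ∀ (α β c₁ c₂ : ℝ) (t : ℕ → ℝ), Nesterenko.Hypothesis θ α β c₁ c₂ t →
        (n : ℝ) - 1 < ((α - 1) * (1 + β)) / (α * (1 + β - α)) →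
        Nesterenko.omega θ ≤
          (((((n : ℝ) - 1) * α * (1 + β - α)) /
            ((α - 1) * (1 + β) - ((n : ℝ) - 1) * α * (1 + β - α)) : ℝ) : EReal) ∧
        ∀ L : Submodule ℝ (Nesterenko.Space n), Module.finrank ℝ L = n →
          Nesterenko.IsRational L →
          ENNReal.ofReal (c * Nesterenko.height L ^
            (-(((α - 1) * (1 + β)) / ((α - 1) * (1 + β) - ((n : ℝ) - 1) * α * (1 + β - α))) - ε))
            ≤ Nesterenko.phi θ L := by
  open Nesterenko in
  by_cases htop : omega θ = ⊤
  · refine ⟨1, one_pos, fun α β c₁ c₂ t H hκ => ?_⟩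
    have := H.omega_le hn hθ hκ
    rw [htop, top_le_iff] at this
    exact absurd this (EReal.coe_ne_top _)
  -- Fixed from `θ` and `ε` alone, so that c does not depend on α, β or the sequence. The maximum
  -- with 0 makes γ nonnegative, as `exists_rpow_le_linForm` requires.
  set γ : ℝ := max (omega θ).toReal 0 + ε with hγ
  have hγ0 : 0 ≤ γ := by positivity
  have hωγ : omega θ < γ := by
    refine (EReal.le_coe_toReal htop).trans_lt (EReal.coe_lt_coe_iff.2 ?_)
    linarith [le_max_left (omega θ).toReal 0]
  obtain ⟨c, hc, hlow⟩ := exists_rpow_le_linForm hγ0 hωγ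
  have hN : 0 < ‖point θ‖ := by linarith [one_le_norm_point θ]
  refine ⟨c / ‖point θ‖, by positivity, fun α β c₁ c₂ t H hκ => ⟨H.omega_le hn hθ hκ, ?_⟩⟩
  intro L hLn hL
  have hω := H.omega_le hn hθ hκ
  obtain ⟨hα, hden⟩ := one_lt_of_lt_div hn H.alpha_pos H.alpha_le_beta hκ
  set Den := (α - 1) * (1 + β) - ((n : ℝ) - 1) * α * (1 + β - α) with hDen
  have hn' : (2 : ℝ) ≤ n := by exact_mod_cast hn
  have hB0 : 0 ≤ (((n : ℝ) - 1) * α * (1 + β - α)) / Den := by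
    have h1 : 0 ≤ (n : ℝ) - 1 := by linarith
    have h2 : 0 ≤ 1 + β - α := by linarith [H.alpha_le_beta]
    positivity
  have hδ : ((α - 1) * (1 + β)) / Den = (((n : ℝ) - 1) * α * (1 + β - α)) / Den + 1 := by
    have : (α - 1) * (1 + β) = ((n : ℝ) - 1) * α * (1 + β - α) + Den := by rw [hDen]; ring
    rw [this, add_div, div_self hden.ne']
  have hγB : γ ≤ (((n : ℝ) - 1) * α * (1 + β - α)) / Den + ε := by
    refine add_le_add (max_le ?_ hB0) le_rfl
    by_cases hbot : omega θ = ⊥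
    · rw [hbot, EReal.toReal_bot]
      exact hB0
    · exact (EReal.toReal_le_toReal hω hbot (EReal.coe_ne_top _)).trans (EReal.toReal_coe _).le
  obtain ⟨q, hq0, hqL, hqH⟩ := hL.exists_normal hLn
  refine le_trans (ENNReal.ofReal_le_ofReal ?_) (ofReal_le_phi θ L hqL)
  rw [← hqH]
  have hH1 : 1 ≤ ‖intPoint q‖ := by
    obtain ⟨i, hi⟩ := Function.ne_iff.1 hq0
    exact (one_le_abs_intCast hi).trans (abs_apply_le_norm_intPoint q i)
  have hH0 : 0 < ‖intPoint q‖ := by linarith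
  calc c / ‖point θ‖ * ‖intPoint q‖ ^ (-((α - 1) * (1 + β) / Den) - ε)
      ≤ c / ‖point θ‖ * ‖intPoint q‖ ^ (-γ - 1) := by
        refine mul_le_mul_of_nonneg_left ?_ (by positivity)
        exact Real.rpow_le_rpow_of_exponent_le hH1 (by linarith)
    _ = c * ‖intPoint q‖ ^ (-γ) / (‖intPoint q‖ * ‖point θ‖) := by
        rw [Real.rpow_sub_one hH0.ne']
        field_simp
    _ ≤ |linForm θ q| / (‖intPoint q‖ * ‖point θ‖) := by
        gcongr
        exact hlow q hq0
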